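/- Let $(X,Y)$ be a bivariate normal random vector with mean vector $(\mu_X,\mu_Y)\in\mathbb{R}^2$, variances $(\sigma_X^2,\sigma_Y^2)$ with $\sigma_X,\sigma_Y>0$, and correlation coefficient $\rho\in(-1,1)$, and let $Z=XY$. Let $n\ge 1$, let $Z_1,\dots,Z_n$ be independent copies of $Z$, and let $S_n=\sum_{i=1}^n Z_i$. Then the distribution of $S_n$ has a unique density $f_{S_n}:\mathbb{R}\to[0,\infty]$ (with respect to Lebesgue measure) that is continuous as a function with values in $[0,\infty]$. This density is bounded on all of $\mathbb{R}$ (that is, there is a finite $M$ with $f_{S_n}(x)\le M$ for all $x\in\mathbb{R}$) if and only if $n\ge 2$. For $n=1$ it has a logarithmic singularity at $x=0$: $f_{S_1}(0)=\infty$, $f_{S_1}(x)<\infty$ for all $x\ne 0$, and there is a constant $c>0$ such that $$f_{S_1}(x)=-c\log|x|+O(1)\qquad\text{as } x\to 0,\ x\neq 0.$$ -/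

import Mathlib

open MeasureTheory ProbabilityTheory Filter Topology Asymptotics
open scoped ENNReal NNReal

/-- The bivariate normal distribution with mean vector `(μX, μY)`, standard deviations `σX, σY`
and correlation coefficient `ρ`. -/
noncomputable def bivariateNormal (μX μY σX σY ρ : ℝ) : Measure (EuclideanSpace ℝ (Fin 2)) :=
  multivariateGaussian !₂[μX, μY] !![σX ^ 2, ρ * σX * σY; ρ * σX * σY, σY ^ 2]

/-- `f` is the continuous version, with values in `[0, ∞]`, of the probability density function of
the real random variable `S` under `P`. The value `∞` is allowed so that a density with a pole
still has a continuous version. -/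
structure IsContinuousPDF {Ω : Type*} [MeasurableSpace Ω] (S : Ω → ℝ) (P : Measure Ω)
    (f : ℝ → ℝ≥0∞) : Prop where
  continuous : Continuous f
  hasLaw : HasLaw S (volume.withDensity f) P

/-- `f` is bounded on the whole real line by a finite constant. -/
def IsBoundedOnReal (f : ℝ → ℝ≥0∞) : Prop :=
  ∃ M : ℝ≥0, ∀ x : ℝ, f x ≤ M

/-- `f` has a logarithmic singularity at `a`: it is infinite at `a`, finite elsewhere, and
`f x = -c log |x - a| + O(1)` as `x → a`, `x ≠ a`, for some constant `c > 0`. -/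
def HasLogSingularityAt (f : ℝ → ℝ≥0∞) (a : ℝ) : Prop :=
  f a = ∞ ∧ (∀ x : ℝ, x ≠ a → f x < ∞) ∧
    ∃ c : ℝ, 0 < c ∧
      (fun x : ℝ => (f x).toReal + c * Real.log |x - a|) =O[𝓝[≠] a] (fun _ => (1 : ℝ))

/-! ### The law of the product as an explicit integral density. -/

section GaussianLaw

/-! Write `Y = βX + W` with `W` Gaussian and independent of `X`. If `g` is the joint density, `XY`
has density `∫ g(x, z/x)/|x| dx`. Folding `x < 0` onto `x > 0` gives `∫_{x>0} k(x, z/x)/x dx` with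
`k(x,y) = g(x,y) + g(-x,-y)`. For small `z` the ranges `(0,|z|]` and `(1,∞)` contribute `O(1)`,
while on `(|z|,1]` the kernel is close to `k(0,0)` and `dx/x` produces `-k(0,0) log|z|`
(`exists_abs_productIntegral_add_log_le`). This is the singularity for `n = 1`, with `c = 2g(0,0)`.

The same integral is `O(|z|^(-1/4))`, so the density is square integrable. A convolution of two
square integrable densities is bounded, hence again square integrable, and it is continuous
(`continuous_lconvolution_of_lintegral_sq`). Induction on the summands settles `n ≥ 2`. Uniqueness
holds because continuous functions that agree almost everywhere are equal. -/

theorem posSemidef_bivariate (σX σY ρ : ℝ) (hρ : -1 < ρ) (hρ' : ρ < 1) :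
    (!![σX ^ 2, ρ * σX * σY; ρ * σX * σY, σY ^ 2] : Matrix (Fin 2) (Fin 2) ℝ).PosSemidef := by
  refine Matrix.PosSemidef.of_dotProduct_mulVec_nonneg ?_ fun x => ?_
  · ext i j
    fin_cases i <;> fin_cases j <;> simp
  · simp [Matrix.mulVec, dotProduct, Fin.sum_univ_two]
    have h : 0 ≤ (1 - ρ ^ 2) * (σY * x 1) ^ 2 :=
      mul_nonneg (by nlinarith) (sq_nonneg _)
    nlinarith [sq_nonneg (σX * x 0 + ρ * (σY * x 1))]

theorem measurable_shear (β : ℝ) :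
    Measurable (fun p : ℝ × ℝ => !₂[p.1, β * p.1 + p.2]) := by
  refine (WithLp.measurable_toLp 2 (Fin 2 → ℝ)).comp ?_
  refine measurable_pi_iff.2 fun i => ?_
  fin_cases i <;> simp <;> fun_prop

/-- The bivariate normal law is obtained by adding to a multiple of the first coordinate an
independent Gaussian variable. -/
theorem bivariateNormal_eq_map (μX μY σX σY ρ : ℝ) (hσX : 0 < σX)
    (hρ : -1 < ρ) (hρ' : ρ < 1) :
    bivariateNormal μX μY σX σY ρ =
      ((gaussianReal μX (σX ^ 2).toNNReal).prod
        (gaussianReal (μY - ρ * σY / σX * μX) (σY ^ 2 * (1 - ρ ^ 2)).toNNReal)).map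
        (fun p => !₂[p.1, ρ * σY / σX * p.1 + p.2]) := by
  set β := ρ * σY / σX with hβ
  have hm := measurable_shear β
  have : IsProbabilityMeasure (((gaussianReal μX (σX ^ 2).toNNReal).prod
      (gaussianReal (μY - β * μX) (σY ^ 2 * (1 - ρ ^ 2)).toNNReal)).map
      (fun p => !₂[p.1, β * p.1 + p.2])) := Measure.isProbabilityMeasure_map hm.aemeasurable
  unfold bivariateNormal
  refine Measure.ext_of_charFun (funext fun t => ?_)
  rw [charFun_multivariateGaussian (posSemidef_bivariate σX σY ρ hρ hρ'), charFun_apply,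
    integral_map hm.aemeasurable (Measurable.aestronglyMeasurable (by fun_prop))]
  -- The exponent is a sum of one term per coordinate, so the characteristic function factors into
  -- two one-dimensional Gaussian ones.
  have hsplit : ∀ p : ℝ × ℝ,
      Complex.exp ((inner ℝ (!₂[p.1, β * p.1 + p.2]) t : ℝ) * Complex.I) =
      Complex.exp (((t 0 + β * t 1 : ℝ) * p.1 : ℂ) * Complex.I) *
        Complex.exp ((t 1 * p.2 : ℂ) * Complex.I) := by
    intro p
    rw [← Complex.exp_add]
    congr 1
    simp [PiLp.inner_apply, Fin.sum_univ_two]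
    ring
  simp_rw [hsplit]
  rw [integral_prod_mul (fun x : ℝ => Complex.exp (((t 0 + β * t 1 : ℝ) * x : ℂ) * Complex.I))
    (fun x : ℝ => Complex.exp ((t 1 * x : ℂ) * Complex.I)), ← charFun_apply_real,
    ← charFun_apply_real, charFun_gaussianReal, charFun_gaussianReal, ← Complex.exp_add]
  have h1 : 0 ≤ σY ^ 2 * (1 - ρ ^ 2) := mul_nonneg (sq_nonneg _) (by nlinarith)
  rw [Real.coe_toNNReal _ h1, Real.coe_toNNReal _ (sq_nonneg _)]
  congr 1
  have h2 : σX ≠ 0 := hσX.ne'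
  simp [PiLp.inner_apply, Fin.sum_univ_two, Matrix.mulVec, dotProduct, hβ]
  have h3 : (σX : ℂ) ≠ 0 := by exact_mod_cast h2
  field_simp
  ring

/-- The law of the product of the coordinates under a density on the plane. -/
theorem map_mul_shear_withDensity (G : ℝ × ℝ → ℝ≥0∞) (hG : Measurable G) (β : ℝ) :
    (((volume : Measure ℝ).prod volume).withDensity G).map (fun p => p.1 * (β * p.1 + p.2)) =
      volume.withDensity
        (fun z => ∫⁻ x, G (x, z / x - β * x) * ENNReal.ofReal |x|⁻¹) := by
  refine Measure.ext_of_lintegral _ fun φ hφ => ?_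
  rw [lintegral_map hφ (by fun_prop), lintegral_withDensity_eq_lintegral_mul _ hG (by fun_prop),
    lintegral_prod _ (Measurable.aemeasurable (by fun_prop)),
    lintegral_withDensity_eq_lintegral_mul _ (by fun_prop) hφ]
  simp only [Pi.mul_apply]
  -- For fixed `x ≠ 0`, shift `y` by `-βx` and then substitute `z = xy`, whose Jacobian is `|x|⁻¹`.
  have hinner : ∀ᵐ x : ℝ, ∫⁻ y, G (x, y) * φ (x * (β * x + y)) =
      ∫⁻ z, G (x, z / x - β * x) * ENNReal.ofReal |x|⁻¹ * φ z := by
    filter_upwards [Measure.ae_ne volume (0 : ℝ)] with x hx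
    rw [← lintegral_add_left_eq_self _ (-(β * x))]
    have hcomp := lintegral_map (μ := (volume : Measure ℝ))
      (f := fun z => G (x, z / x - β * x) * φ z) (g := fun y => x * y) (by fun_prop) (by fun_prop)
    rw [Real.map_volume_mul_left hx, lintegral_smul_measure] at hcomp
    calc _ = ∫⁻ y, G (x, (x * y) / x - β * x) * φ (x * y) := by
          refine lintegral_congr fun y => ?_
          rw [mul_div_cancel_left₀ _ hx]
          congr 2 <;> ring_nf
      _ = _ := by
          rw [← hcomp, smul_eq_mul, ← lintegral_const_mul _ (by fun_prop), abs_inv]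
          refine lintegral_congr fun z => ?_
          ring
  rw [lintegral_congr_ae hinner, lintegral_lintegral_swap]
  · refine lintegral_congr fun z => ?_
    rw [lintegral_mul_const _ (by fun_prop)]
  · exact Measurable.aemeasurable (by fun_prop)

/-- The joint density of a normal bivariate vector, as a product of marginal and conditional
densities. -/
noncomputable def jointPDF (m₁ : ℝ) (v₁ : ℝ≥0) (m₂ : ℝ) (v₂ : ℝ≥0) (β x y : ℝ) : ℝ :=
  gaussianPDFReal m₁ v₁ x * gaussianPDFReal m₂ v₂ (y - β * x)

theorem map_mul_gaussian (m₁ m₂ β : ℝ) {v₁ v₂ : ℝ≥0} (h₁ : v₁ ≠ 0) (h₂ : v₂ ≠ 0) :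
    ((gaussianReal m₁ v₁).prod (gaussianReal m₂ v₂)).map (fun p => p.1 * (β * p.1 + p.2)) =
      volume.withDensity
        (fun z => ∫⁻ x, ENNReal.ofReal (jointPDF m₁ v₁ m₂ v₂ β x (z / x) / |x|)) := by
  rw [gaussianReal_of_var_ne_zero _ h₁, gaussianReal_of_var_ne_zero _ h₂,
    prod_withDensity (measurable_gaussianPDF _ _) (measurable_gaussianPDF _ _),
    map_mul_shear_withDensity _ (by fun_prop)]
  congr 1
  ext z
  refine lintegral_congr fun x => ?_
  rw [jointPDF, div_eq_mul_inv _ |x|, ENNReal.ofReal_mul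
    (mul_nonneg (gaussianPDFReal_nonneg _ _ _) (gaussianPDFReal_nonneg _ _ _)),
    ENNReal.ofReal_mul (gaussianPDFReal_nonneg _ _ _)]
  rfl

end GaussianLaw

/-! ### Size and asymptotics of the product integral. -/

section ProductKernel

/-- A nonnegative continuous kernel on the plane with Gaussian decay that is positive at the origin
and satisfies a Lipschitz bound there. -/
structure IsGaussianKernel (k : ℝ → ℝ → ℝ) (C a L : ℝ) : Prop where
  continuous : Continuous fun p : ℝ × ℝ => k p.1 p.2
  nonneg : ∀ x y, 0 ≤ k x y
  pos : 0 < k 0 0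
  decay_pos : 0 < a
  le : ∀ x y, k x y ≤ C * Real.exp (-a * (x ^ 2 + y ^ 2))
  lip : ∀ x y, |x| ≤ 1 → |y| ≤ 1 → |k x y - k 0 0| ≤ L * (|x| + |y|)

/-- The integral giving the density at `z` of the product of two positive variables with joint
density `k`. -/
noncomputable def productIntegral (k : ℝ → ℝ → ℝ) (z : ℝ) : ℝ :=
  ∫ x in Set.Ioi (0 : ℝ), k x (z / x) / x

/-- Any exponent `s` in `(0, 1/2)` would serve in place of `1/4`: `x^(s-1)` must be integrable at
`0` and `|z|^(-s)` square integrable there. -/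
theorem rpow_mul_exp_neg_mul_sq_le {a : ℝ} (ha : 0 < a) {y : ℝ} (hy : 0 ≤ y) :
    y ^ (1 / 4 : ℝ) * Real.exp (-a * y ^ 2) ≤ 1 + 1 / a := by
  have h1 : y ^ (1 / 4 : ℝ) ≤ 1 + y ^ 2 := by
    rcases le_total y 1 with h | h
    · have := Real.rpow_le_one hy h (by norm_num : (0 : ℝ) ≤ 1 / 4)
      nlinarith [sq_nonneg y]
    · have := Real.rpow_le_rpow_of_exponent_le h (by norm_num : (1 / 4 : ℝ) ≤ 2)
      rw [Real.rpow_two] at this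
      linarith
  have h2 : 0 < 1 + a * y ^ 2 := by positivity
  have h3 : Real.exp (-a * y ^ 2) ≤ 1 / (1 + a * y ^ 2) := by
    rw [neg_mul, Real.exp_neg, one_div]
    exact inv_anti₀ h2 (by linarith [Real.add_one_le_exp (a * y ^ 2)])
  calc _ ≤ (1 + y ^ 2) * (1 / (1 + a * y ^ 2)) := by gcongr
    _ ≤ 1 + 1 / a := by
      rw [mul_one_div, div_le_iff₀ h2]
      have : (1 + 1 / a) * (1 + a * y ^ 2) = 1 + y ^ 2 + (a * y ^ 2 + 1 / a) := by
        field_simp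
        ring
      rw [this]
      have : 0 ≤ a * y ^ 2 + 1 / a := by positivity
      linarith

namespace IsGaussianKernel

variable {k : ℝ → ℝ → ℝ} {C a L : ℝ}

theorem const_pos (h : IsGaussianKernel k C a L) : 0 < C := by
  have := h.le 0 0
  simp only [ne_eq, OfNat.ofNat_ne_zero, not_false_eq_true, zero_pow, add_zero, mul_zero,
    Real.exp_zero, mul_one] at this
  exact h.pos.trans_le this

theorem lip_nonneg (h : IsGaussianKernel k C a L) : 0 ≤ L := by
  have := (abs_nonneg _).trans (h.lip 1 0 (by simp) (by simp))
  simpa using this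

theorem le_exp_left (h : IsGaussianKernel k C a L) (x y : ℝ) :
    k x y ≤ C * Real.exp (-a * x ^ 2) := by
  refine (h.le x y).trans (mul_le_mul_of_nonneg_left (Real.exp_le_exp.2 ?_) h.const_pos.le)
  nlinarith [mul_nonneg h.decay_pos.le (sq_nonneg y)]

theorem le_exp_right (h : IsGaussianKernel k C a L) (x y : ℝ) :
    k x y ≤ C * Real.exp (-a * y ^ 2) := by
  refine (h.le x y).trans (mul_le_mul_of_nonneg_left (Real.exp_le_exp.2 ?_) h.const_pos.le)
  nlinarith [mul_nonneg h.decay_pos.le (sq_nonneg x)]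

theorem integrand_nonneg (h : IsGaussianKernel k C a L) {x : ℝ} (hx : 0 < x) (z : ℝ) :
    0 ≤ k x (z / x) / x :=
  div_nonneg (h.nonneg _ _) hx.le

/-- The decay in `z/x` pays for the factor `(x/|z|)^(1/4)`, and the decay in `x` is kept. The
variables separate, giving one majorant for integrability, continuity and the power bound. -/
theorem integrand_le (h : IsGaussianKernel k C a L) {x z : ℝ} (hx : 0 < x) (hz : z ≠ 0) :
    k x (z / x) / x ≤
      C * (1 + 1 / a) * |z| ^ (-(1 / 4) : ℝ) *
        (x ^ (-(3 / 4) : ℝ) * Real.exp (-a * x ^ 2)) := by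
  have hz' : 0 < |z| := abs_pos.2 hz
  have hy : 0 < |z| / x := div_pos hz' hx
  have h1 := rpow_mul_exp_neg_mul_sq_le h.decay_pos hy.le
  have h2 : Real.exp (-a * (|z| / x) ^ 2) ≤
      (1 + 1 / a) * (|z| ^ (-(1 / 4) : ℝ) * x ^ (1 / 4 : ℝ)) := by
    have h3 : |z| ^ (-(1 / 4) : ℝ) * x ^ (1 / 4 : ℝ) = ((|z| / x) ^ (1 / 4 : ℝ))⁻¹ := by
      rw [Real.div_rpow hz'.le hx.le, Real.rpow_neg hz'.le, inv_div, inv_mul_eq_div]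
    rw [h3, ← div_eq_mul_inv, le_div_iff₀ (by positivity), mul_comm]
    exact h1
  have h4 : x ^ (-(3 / 4) : ℝ) = x ^ (1 / 4 : ℝ) / x := by
    rw [← Real.rpow_sub_one hx.ne']
    norm_num
  have h5 : k x (z / x) ≤
      C * Real.exp (-a * x ^ 2) * ((1 + 1 / a) * (|z| ^ (-(1 / 4) : ℝ) * x ^ (1 / 4 : ℝ))) := by
    refine (h.le _ _).trans ?_
    rw [mul_add, Real.exp_add, ← mul_assoc]
    refine mul_le_mul_of_nonneg_left ?_ (mul_nonneg h.const_pos.le (Real.exp_pos _).le)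
    rwa [← sq_abs (z / x), abs_div, abs_of_pos hx]
  rw [h4, div_le_iff₀ hx]
  refine h5.trans (le_of_eq ?_)
  field_simp

theorem integrableOn_bound (h : IsGaussianKernel k C a L) :
    IntegrableOn (fun x : ℝ => x ^ (-(3 / 4) : ℝ) * Real.exp (-a * x ^ 2)) (Set.Ioi 0) :=
  integrableOn_rpow_mul_exp_neg_mul_sq h.decay_pos (by norm_num)

theorem measurable_integrand (h : IsGaussianKernel k C a L) (z : ℝ) :
    Measurable fun x => k x (z / x) / x := by
  have h1 : Measurable fun x : ℝ => k x (z / x) :=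
    h.continuous.measurable.comp (measurable_id.prodMk (measurable_const.div measurable_id))
  exact h1.div measurable_id

theorem integrableOn_integrand (h : IsGaussianKernel k C a L) {z : ℝ} (hz : z ≠ 0) :
    IntegrableOn (fun x => k x (z / x) / x) (Set.Ioi 0) := by
  refine Integrable.mono' (h.integrableOn_bound.const_mul
    (C * (1 + 1 / a) * |z| ^ (-(1 / 4) : ℝ))) (h.measurable_integrand z).aestronglyMeasurable ?_
  filter_upwards [ae_restrict_mem measurableSet_Ioi] with x hx
  rw [Real.norm_of_nonneg (h.integrand_nonneg hx z)]
  exact h.integrand_le hx hz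

theorem productIntegral_nonneg (h : IsGaussianKernel k C a L) (z : ℝ) :
    0 ≤ productIntegral k z :=
  setIntegral_nonneg measurableSet_Ioi fun _ hx => h.integrand_nonneg hx z

theorem exists_productIntegral_le_rpow (h : IsGaussianKernel k C a L) :
    ∃ K : ℝ, 0 ≤ K ∧ ∀ z, z ≠ 0 → productIntegral k z ≤ K * |z| ^ (-(1 / 4) : ℝ) := by
  refine ⟨C * (1 + 1 / a) *
    ∫ x in Set.Ioi (0 : ℝ), x ^ (-(3 / 4) : ℝ) * Real.exp (-a * x ^ 2), ?_, fun z hz => ?_⟩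
  · have := h.const_pos
    have := h.decay_pos
    refine mul_nonneg (by positivity) (setIntegral_nonneg measurableSet_Ioi fun x hx => ?_)
    exact mul_nonneg (Real.rpow_nonneg (le_of_lt hx) _) (Real.exp_pos _).le
  · rw [mul_right_comm, ← integral_const_mul]
    exact setIntegral_mono_on (h.integrableOn_integrand hz) (h.integrableOn_bound.const_mul _)
      measurableSet_Ioi fun x hx => h.integrand_le hx hz

theorem continuousAt_productIntegral (h : IsGaussianKernel k C a L) {z : ℝ} (hz : z ≠ 0) :
    ContinuousAt (productIntegral k) z := by
  have hC := h.const_pos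
  have ha := h.decay_pos
  have hz' : 0 < |z| := abs_pos.2 hz
  refine continuousAt_of_dominated
    (bound := fun x => C * (1 + 1 / a) * (|z| / 2) ^ (-(1 / 4) : ℝ) *
        (x ^ (-(3 / 4) : ℝ) * Real.exp (-a * x ^ 2))) ?_ ?_ (h.integrableOn_bound.const_mul _) ?_
  · exact .of_forall fun w => (h.measurable_integrand w).aestronglyMeasurable
  · have hev : ∀ᶠ w in 𝓝 z, |z| / 2 < |w| :=
      continuous_abs.continuousAt.eventually_const_lt (half_lt_self hz')
    filter_upwards [hev] with w hw
    filter_upwards [ae_restrict_mem measurableSet_Ioi] with x hx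
    have hx' : 0 < x := hx
    have hw0 : w ≠ 0 := abs_pos.1 ((half_pos hz').trans hw)
    rw [Real.norm_of_nonneg (h.integrand_nonneg hx w)]
    refine (h.integrand_le hx hw0).trans ?_
    refine mul_le_mul_of_nonneg_right (mul_le_mul_of_nonneg_left ?_ (by positivity))
      (by positivity)
    exact Real.rpow_le_rpow_of_nonpos (half_pos hz') hw.le (by norm_num)
  · filter_upwards [ae_restrict_mem measurableSet_Ioi] with x hx
    have : Continuous fun w : ℝ => k x (w / x) / x :=
      (h.continuous.comp (continuous_const.prodMk (continuous_id.div_const x))).div_const x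
    exact this.continuousAt

/-- By `e^(-t) ≤ 1/t` the integrand is at most `Cx/(az²) ≤ C/(a|z|)`, on an interval of length
`|z|`. -/
theorem norm_integral_Ioc_zero_le (h : IsGaussianKernel k C a L) {z : ℝ} (hz : z ≠ 0) :
    ‖∫ x in Set.Ioc 0 |z|, k x (z / x) / x‖ ≤ C / a := by
  have hC := h.const_pos
  have ha := h.decay_pos
  have hz' : 0 < |z| := abs_pos.2 hz
  have := norm_setIntegral_le_of_norm_le_const (μ := volume) (s := Set.Ioc 0 |z|)
    (f := fun x => k x (z / x) / x) (C := C / (a * |z|)) (by simp) fun x hx => by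
      have hx0 : 0 < x := hx.1
      rw [Real.norm_of_nonneg (h.integrand_nonneg hx0 z), div_le_iff₀ hx0]
      refine (h.le_exp_right _ _).trans ?_
      have h1 : Real.exp (-a * (z / x) ^ 2) ≤ 1 / (a * (z / x) ^ 2) := by
        rw [neg_mul, Real.exp_neg, one_div]
        exact inv_anti₀ (by positivity) (by linarith [Real.add_one_le_exp (a * (z / x) ^ 2)])
      calc _ ≤ C * (1 / (a * (z / x) ^ 2)) := by gcongr
        _ = C * x / (a * |z|) * (x / |z|) := by
          rw [div_pow, ← sq_abs z]
          field_simp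
        _ ≤ C * x / (a * |z|) * 1 := by
          refine mul_le_mul_of_nonneg_left ?_ (by positivity)
          rw [div_le_one hz']
          exact hx.2
        _ = _ := by ring
  refine this.trans (le_of_eq ?_)
  simp only [measureReal_def, Real.volume_Ioc, sub_zero, ENNReal.toReal_ofReal hz'.le]
  field_simp

theorem norm_integral_Ioi_one_le (h : IsGaussianKernel k C a L) (z : ℝ) :
    ‖∫ x in Set.Ioi 1, k x (z / x) / x‖ ≤ ∫ x in Set.Ioi 1, C * Real.exp (-a * x ^ 2) := by
  refine norm_integral_le_of_norm_le
    ((integrable_exp_neg_mul_sq h.decay_pos).integrableOn.const_mul C) ?_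
  filter_upwards [ae_restrict_mem measurableSet_Ioi] with x hx
  have hx1 : 1 < x := hx
  have hx0 : 0 < x := one_pos.trans hx1
  rw [Real.norm_of_nonneg (h.integrand_nonneg hx0 z)]
  exact (div_le_self (h.nonneg _ _) hx1.le).trans (h.le_exp_left _ _)

/-- Here `x` and `|z/x|` are both at most `1`, so the Lipschitz bound applies. The error `L(1 +
|z|/x²)` has primitive `L(x - |z|/x)`, whose increment over `[|z|, 1]` is `2L(1 - |z|)`. -/
theorem abs_integral_add_log_le (h : IsGaussianKernel k C a L) {z : ℝ} (hz : z ≠ 0)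
    (hz1 : |z| < 1) :
    |(∫ x in Set.Ioc |z| 1, k x (z / x) / x) + k 0 0 * Real.log (|z|)| ≤ 2 * L := by
  have hz' : 0 < |z| := abs_pos.2 hz
  have hL := h.lip_nonneg
  have hpos : ∀ x ∈ Set.uIcc |z| 1, 0 < x := by
    intro x hx
    rw [Set.uIcc_of_le hz1.le] at hx
    exact hz'.trans_le hx.1
  have hlog : ∫ x in |z|..1, k 0 0 * x⁻¹ = -(k 0 0 * Real.log |z|) := by
    rw [intervalIntegral.integral_const_mul, integral_inv_of_pos hz' one_pos, one_div,
      Real.log_inv]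
    ring
  have hint1 : IntervalIntegrable (fun x => k x (z / x) / x) volume |z| 1 := by
    rw [intervalIntegrable_iff_integrableOn_Ioc_of_le hz1.le]
    exact (h.integrableOn_integrand hz).mono_set fun x hx => hz'.trans hx.1
  have hint2 : IntervalIntegrable (fun x => k 0 0 * x⁻¹) volume |z| 1 :=
    (intervalIntegral.intervalIntegrable_inv (fun x hx => (hpos x hx).ne')
      continuousOn_id).const_mul _
  have hderiv : ∀ x ∈ Set.uIcc |z| 1,
      HasDerivAt (fun x => L * (x - |z| * x⁻¹)) (L * (1 + |z| * (x ^ 2)⁻¹)) x := by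
    intro x hx
    have := ((hasDerivAt_id x).sub ((hasDerivAt_inv (hpos x hx).ne').const_mul |z|)).const_mul L
    exact this.congr_deriv (by ring)
  have hcont : ContinuousOn (fun x => L * (1 + |z| * (x ^ 2)⁻¹)) (Set.uIcc |z| 1) := by
    refine continuousOn_const.mul (continuousOn_const.add (continuousOn_const.mul
      (ContinuousOn.inv₀ (by fun_prop) fun x hx => ?_)))
    exact (pow_pos (hpos x hx) 2).ne'
  have heq := intervalIntegral.integral_eq_sub_of_hasDerivAt hderiv hcont.intervalIntegrable
  rw [← intervalIntegral.integral_of_le hz1.le, ← neg_neg (k 0 0 * Real.log |z|), ← hlog,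
    ← sub_eq_add_neg, ← intervalIntegral.integral_sub hint1 hint2]
  have hle := intervalIntegral.norm_integral_le_of_norm_le
    (f := fun x => k x (z / x) / x - k 0 0 * x⁻¹) hz1.le (μ := volume)
    (g := fun x => L * (1 + |z| * (x ^ 2)⁻¹)) (Eventually.of_forall fun x hx => by
      have hx0 : 0 < x := hz'.trans hx.1
      have hxz : |z / x| ≤ 1 := by
        rw [abs_div, abs_of_pos hx0, div_le_one hx0]
        exact hx.1.le
      have h1 := h.lip x (z / x) (by rw [abs_of_pos hx0]; exact hx.2) hxz
      rw [← div_eq_mul_inv, ← sub_div, norm_div, Real.norm_eq_abs, Real.norm_eq_abs,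
        abs_of_pos hx0, div_le_iff₀ hx0]
      refine h1.trans (le_of_eq ?_)
      rw [abs_div, abs_of_pos hx0]
      field_simp) hcont.intervalIntegrable
  rw [heq] at hle
  rw [Real.norm_eq_abs] at hle
  refine hle.trans ?_
  rw [mul_inv_cancel₀ hz'.ne']
  nlinarith [mul_nonneg hL hz'.le]

/-- The logarithmic asymptotics of the density of a product near the origin. -/
theorem exists_abs_productIntegral_add_log_le (h : IsGaussianKernel k C a L) :
    ∃ M : ℝ, ∀ z, z ≠ 0 → |z| < 1 → |productIntegral k z + k 0 0 * Real.log (|z|)| ≤ M := by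
  refine ⟨C / a + 2 * L + ∫ x in Set.Ioi 1, C * Real.exp (-a * x ^ 2), fun z hz hz1 => ?_⟩
  have hz' : 0 < |z| := abs_pos.2 hz
  have hI := h.integrableOn_integrand hz
  have hsplit : productIntegral k z = (∫ x in Set.Ioc 0 |z|, k x (z / x) / x) +
      (∫ x in Set.Ioc |z| 1, k x (z / x) / x) + ∫ x in Set.Ioi 1, k x (z / x) / x := by
    rw [productIntegral, ← setIntegral_union _ measurableSet_Ioc
      (hI.mono_set fun x hx => hx.1) (hI.mono_set fun x hx => hz'.trans hx.1),
      Set.Ioc_union_Ioc_eq_Ioc hz'.le hz1.le, ← setIntegral_union _ measurableSet_Ioi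
      (hI.mono_set fun x hx => hx.1) (hI.mono_set fun x hx => one_pos.trans hx),
      Set.Ioc_union_Ioi_eq_Ioi zero_le_one]
    · exact Set.Ioc_disjoint_Ioi le_rfl
    · exact Set.Ioc_disjoint_Ioc_of_le le_rfl
  have h1 := abs_le.1 (h.norm_integral_Ioc_zero_le hz)
  have h2 := abs_le.1 (h.abs_integral_add_log_le hz hz1)
  have h3 := abs_le.1 (h.norm_integral_Ioi_one_le z)
  rw [hsplit, abs_le]
  constructor <;> linarith [h1.1, h1.2, h2.1, h2.2, h3.1, h3.2]

end IsGaussianKernel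

end ProductKernel

/-! ### Gaussian densities as kernels, and the product density. -/

section GaussianKernel

theorem Real.abs_exp_neg_sub_exp_neg_le {s t : ℝ} (hs : 0 ≤ s) (ht : 0 ≤ t) :
    |Real.exp (-s) - Real.exp (-t)| ≤ |s - t| := by
  wlog hst : s ≤ t generalizing s t
  · rw [abs_sub_comm, abs_sub_comm s]
    exact this ht hs (le_of_not_ge hst)
  rw [abs_of_nonneg (sub_nonneg.2 (Real.exp_le_exp.2 (neg_le_neg hst))), abs_sub_comm,
    abs_of_nonneg (sub_nonneg.2 hst)]
  have h1 : Real.exp (-t) = Real.exp (-s) * Real.exp (-(t - s)) := by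
    rw [← Real.exp_add]
    ring_nf
  have h2 := Real.add_one_le_exp (-(t - s))
  have h3 : Real.exp (-s) ≤ 1 := Real.exp_le_one_iff.2 (by linarith)
  have h4 : Real.exp (-s) * (1 - (t - s)) ≤ Real.exp (-s) * Real.exp (-(t - s)) :=
    mul_le_mul_of_nonneg_left (by linarith) (Real.exp_pos _).le
  rw [h1]
  nlinarith [mul_nonneg (sub_nonneg.2 h3) (sub_nonneg.2 hst)]

/-- Coercivity of the correlated quadratic form, which yields Gaussian decay in `x` and `y` jointly.
-/
theorem sq_add_sq_le_quadratic {A B : ℝ} (hA : 0 < A) (hB : 0 < B) (m₁ m₂ β x y : ℝ) :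
    x ^ 2 + y ^ 2 ≤ ((2 + 6 * β ^ 2) / A + 3 / B) *
      (A * (x - m₁) ^ 2 + B * (y - β * x - m₂) ^ 2) +
      ((1 + 3 * β ^ 2) * (2 * m₁ ^ 2) + 3 * m₂ ^ 2) := by
  have hx : x ^ 2 ≤ 2 * ((x - m₁) ^ 2 + m₁ ^ 2) := by nlinarith [sq_nonneg (x - 2 * m₁)]
  have hy : y ^ 2 ≤ 3 * ((y - β * x - m₂) ^ 2 + β ^ 2 * x ^ 2 + m₂ ^ 2) := by
    nlinarith [sq_nonneg (y - β * x - m₂ - β * x), sq_nonneg (y - β * x - m₂ - m₂),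
      sq_nonneg (β * x - m₂)]
  have h1 : ((2 + 6 * β ^ 2) / A + 3 / B) * (A * (x - m₁) ^ 2 + B * (y - β * x - m₂) ^ 2) =
      (2 + 6 * β ^ 2) * (x - m₁) ^ 2 + 3 * (y - β * x - m₂) ^ 2 +
      ((2 + 6 * β ^ 2) * B / A * (y - β * x - m₂) ^ 2 + 3 * A / B * (x - m₁) ^ 2) := by
    field_simp
    ring
  have h2 : 0 ≤ (2 + 6 * β ^ 2) * B / A * (y - β * x - m₂) ^ 2 + 3 * A / B * (x - m₁) ^ 2 := by
    positivity
  rw [h1]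
  nlinarith [mul_le_mul_of_nonneg_left hx (by positivity : 0 ≤ 1 + 3 * β ^ 2)]

theorem abs_quadratic_sub_le {A B : ℝ} (hA : 0 < A) (hB : 0 < B) (m₁ m₂ β : ℝ) {x y : ℝ}
    (hx : |x| ≤ 1) (hy : |y| ≤ 1) :
    |(A * (x - m₁) ^ 2 + B * (y - β * x - m₂) ^ 2) -
      (A * (0 - m₁) ^ 2 + B * (0 - β * 0 - m₂) ^ 2)| ≤
      (A * (1 + 2 * |m₁|) + B * (1 + |β|) * (1 + |β| + 2 * |m₂|)) * (|x| + |y|) := by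
  have h1 : (A * (x - m₁) ^ 2 + B * (y - β * x - m₂) ^ 2) -
      (A * (0 - m₁) ^ 2 + B * (0 - β * 0 - m₂) ^ 2) =
      A * (x * (x - 2 * m₁)) + B * ((y - β * x) * (y - β * x - 2 * m₂)) := by ring
  have h2 : |x - 2 * m₁| ≤ 1 + 2 * |m₁| := by
    refine (abs_sub _ _).trans ?_
    rw [abs_mul, abs_two]
    linarith
  have h3 : |y - β * x| ≤ (1 + |β|) * (|x| + |y|) := by
    refine (abs_sub _ _).trans ?_
    rw [abs_mul]
    nlinarith [abs_nonneg x, mul_nonneg (abs_nonneg β) (abs_nonneg y)]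
  have h4 : |y - β * x - 2 * m₂| ≤ 1 + |β| + 2 * |m₂| := by
    refine (abs_sub _ _).trans ?_
    rw [abs_mul 2, abs_two]
    have := (abs_sub y (β * x))
    rw [abs_mul] at this
    nlinarith [abs_nonneg β]
  rw [h1]
  refine (abs_add_le _ _).trans ?_
  rw [abs_mul, abs_mul B, abs_of_pos hA, abs_of_pos hB, abs_mul, abs_mul]
  calc _ ≤ A * (|x| * (1 + 2 * |m₁|)) +
        B * (((1 + |β|) * (|x| + |y|)) * (1 + |β| + 2 * |m₂|)) := by gcongr
    _ ≤ A * ((|x| + |y|) * (1 + 2 * |m₁|)) +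
        B * (((1 + |β|) * (|x| + |y|)) * (1 + |β| + 2 * |m₂|)) := by
      gcongr
      linarith [abs_nonneg y]
    _ = _ := by ring

theorem isGaussianKernel_exp_neg_quadratic {K A B : ℝ} (hK : 0 < K) (hA : 0 < A) (hB : 0 < B)
    (m₁ m₂ β : ℝ) :
    ∃ C a L, IsGaussianKernel
      (fun x y => K * Real.exp (-(A * (x - m₁) ^ 2 + B * (y - β * x - m₂) ^ 2))) C a L := by
  set D := (2 + 6 * β ^ 2) / A + 3 / B
  have hD : 0 < D := by positivity
  set E := (1 + 3 * β ^ 2) * (2 * m₁ ^ 2) + 3 * m₂ ^ 2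
  -- Coercivity reads `x² + y² ≤ DQ + E`, so `-Q ≤ E/D - (x² + y²)/D`.
  refine ⟨K * Real.exp (E / D), 1 / D,
    K * (A * (1 + 2 * |m₁|) + B * (1 + |β|) * (1 + |β| + 2 * |m₂|)),
    by fun_prop, fun x y => by positivity, by positivity, by positivity, fun x y => ?_,
    fun x y hx hy => ?_⟩
  · rw [mul_assoc, ← Real.exp_add]
    refine mul_le_mul_of_nonneg_left (Real.exp_le_exp.2 ?_) hK.le
    have h := sq_add_sq_le_quadratic hA hB m₁ m₂ β x y
    have h' : (x ^ 2 + y ^ 2 - E) / D ≤ A * (x - m₁) ^ 2 + B * (y - β * x - m₂) ^ 2 := by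
      rw [div_le_iff₀ hD, mul_comm]
      linarith
    have h2 : E / D + -(1 / D) * (x ^ 2 + y ^ 2) = -((x ^ 2 + y ^ 2 - E) / D) := by ring
    rw [h2]
    exact neg_le_neg h'
  · rw [← mul_sub, abs_mul, abs_of_pos hK, mul_assoc K]
    refine mul_le_mul_of_nonneg_left ?_ hK.le
    exact (Real.abs_exp_neg_sub_exp_neg_le (by positivity) (by positivity)).trans
      (abs_quadratic_sub_le hA hB m₁ m₂ β hx hy)

theorem isGaussianKernel_jointPDF (m₁ m₂ β : ℝ) {v₁ v₂ : ℝ≥0} (h₁ : v₁ ≠ 0) (h₂ : v₂ ≠ 0) :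
    ∃ C a L, IsGaussianKernel (jointPDF m₁ v₁ m₂ v₂ β) C a L := by
  have hv₁ : (0 : ℝ) < v₁ := by exact_mod_cast pos_iff_ne_zero.2 h₁
  have hv₂ : (0 : ℝ) < v₂ := by exact_mod_cast pos_iff_ne_zero.2 h₂
  have hK : 0 < (√(2 * Real.pi * v₁))⁻¹ * (√(2 * Real.pi * v₂))⁻¹ := by
    have := Real.pi_pos
    positivity
  have h := isGaussianKernel_exp_neg_quadratic hK
    (by positivity : 0 < 1 / (2 * (v₁ : ℝ))) (by positivity : 0 < 1 / (2 * (v₂ : ℝ))) m₁ m₂ β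
  convert h using 7 with C a L
  ext x y
  rw [jointPDF, gaussianPDFReal, gaussianPDFReal, mul_mul_mul_comm, ← Real.exp_add]
  congr 2
  ring

/-- Replacing `x` by `-x` sends `(x, z/x)` to its negative, so this symmetrised kernel reduces the
whole line to the half-line `x > 0`. -/
theorem IsGaussianKernel.add_neg {g : ℝ → ℝ → ℝ} {C a L : ℝ} (h : IsGaussianKernel g C a L) :
    IsGaussianKernel (fun x y => g x y + g (-x) (-y)) (2 * C) a (2 * L) where
  continuous := h.continuous.add
    (h.continuous.comp (continuous_fst.neg.prodMk continuous_snd.neg))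
  nonneg x y := add_nonneg (h.nonneg _ _) (h.nonneg _ _)
  pos := by simpa using h.pos
  decay_pos := h.decay_pos
  le x y := by
    have h1 := h.le x y
    have h2 := h.le (-x) (-y)
    rw [neg_sq, neg_sq] at h2
    linarith
  lip x y hx hy := by
    have h1 := h.lip x y hx hy
    have h2 := h.lip (-x) (-y) (by rwa [abs_neg]) (by rwa [abs_neg])
    rw [abs_neg, abs_neg] at h2
    rw [neg_zero, add_sub_add_comm]
    exact (abs_add_le _ _).trans (by linarith)

theorem eventually_abs_lt_one_nhdsNE : ∀ᶠ x : ℝ in 𝓝[≠] 0, |x| < 1 := by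
  refine nhdsWithin_le_nhds ?_
  have : Continuous fun x : ℝ => |x| := continuous_abs
  exact this.continuousAt.eventually_lt_const (by simp)

/-- The continuous version, with values in `[0, ∞]`, of the density of the product of the
coordinates of a vector with joint density `g`. -/
noncomputable def productDensity (g : ℝ → ℝ → ℝ) (z : ℝ) : ℝ≥0∞ :=
  if z = 0 then ∞ else ENNReal.ofReal (productIntegral (fun x y => g x y + g (-x) (-y)) z)

namespace IsGaussianKernel

variable {g : ℝ → ℝ → ℝ} {C a L : ℝ}

theorem lintegral_eq_productDensity (h : IsGaussianKernel g C a L) {z : ℝ} (hz : z ≠ 0) :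
    ∫⁻ x, ENNReal.ofReal (g x (z / x) / |x|) = productDensity g z := by
  have hmeas : Measurable fun x => ENNReal.ofReal (g x (z / x) / |x|) := by
    have h1 : Measurable fun x : ℝ => g x (z / x) :=
      h.continuous.measurable.comp (measurable_id.prodMk (measurable_const.div measurable_id))
    exact (h1.div measurable_id.norm).ennreal_ofReal
  have hneg : ∫⁻ x in Set.Iio 0, ENNReal.ofReal (g x (z / x) / |x|) =
      ∫⁻ x in Set.Ioi 0, ENNReal.ofReal (g (-x) (z / -x) / |(-x)|) := by
    rw [← (Measure.measurePreserving_neg (volume : Measure ℝ)).setLIntegral_comp_preimage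
      measurableSet_Iio hmeas]
    simp
  rw [productDensity, if_neg hz, productIntegral, ofReal_integral_eq_lintegral_ofReal
    (h.add_neg.integrableOn_integrand hz)
    (by filter_upwards [ae_restrict_mem measurableSet_Ioi] with x hx using
      h.add_neg.integrand_nonneg hx z),
    ← lintegral_add_compl _ (measurableSet_Ioi (a := (0 : ℝ))), Set.compl_Ioi,
    setLIntegral_congr Iio_ae_eq_Iic.symm, hneg, ← lintegral_add_left hmeas]
  refine setLIntegral_congr_fun measurableSet_Ioi fun x hx => ?_
  have hx0 : 0 < x := hx
  simp only [abs_neg, abs_of_pos hx0]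
  rw [← ENNReal.ofReal_add (div_nonneg (h.nonneg _ _) hx0.le) (div_nonneg (h.nonneg _ _) hx0.le),
    div_neg, add_div]

theorem productDensity_le_rpow (h : IsGaussianKernel g C a L) :
    ∃ K : ℝ, 0 ≤ K ∧ ∀ z, z ≠ 0 →
      productDensity g z ≤ ENNReal.ofReal (K * |z| ^ (-(1 / 4) : ℝ)) := by
  obtain ⟨K, hK, hle⟩ := h.add_neg.exists_productIntegral_le_rpow
  refine ⟨K, hK, fun z hz => ?_⟩
  rw [productDensity, if_neg hz]
  exact ENNReal.ofReal_le_ofReal (hle z hz)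

/-- At `0` continuity means divergence to `∞`, supplied by the logarithmic asymptotics; elsewhere it
comes from dominated convergence. -/
theorem continuous_productDensity (h : IsGaussianKernel g C a L) :
    Continuous (productDensity g) := by
  refine continuous_iff_continuousAt.2 fun z => ?_
  by_cases hz : z = 0
  · subst hz
    rw [continuousAt_iff_punctured_nhds, productDensity, if_pos rfl]
    obtain ⟨M, hM⟩ := h.add_neg.exists_abs_productIntegral_add_log_le
    have hlog : Tendsto (fun z : ℝ => -M + -(g 0 0 + g (-0) (-0)) * Real.log z) (𝓝[≠] 0) atTop :=
      tendsto_atTop_add_const_left _ _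
        (Real.tendsto_log_nhdsNE_zero.const_mul_atBot_of_neg (neg_neg_of_pos h.add_neg.pos))
    have hatTop : Tendsto (productIntegral (fun x y => g x y + g (-x) (-y))) (𝓝[≠] 0) atTop := by
      refine tendsto_atTop_mono' _ ?_ hlog
      filter_upwards [self_mem_nhdsWithin, eventually_abs_lt_one_nhdsNE] with x hx hx1
      have := (abs_le.1 (hM x hx hx1)).1
      rw [Real.log_abs] at this
      linarith
    refine (ENNReal.tendsto_ofReal_atTop.comp hatTop).congr' ?_
    filter_upwards [self_mem_nhdsWithin] with x hx
    rw [productDensity, if_neg (show x ≠ 0 from hx), Function.comp]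
  · have h1 : ContinuousAt
        (fun z => ENNReal.ofReal (productIntegral (fun x y => g x y + g (-x) (-y)) z)) z :=
      ENNReal.continuous_ofReal.continuousAt.comp (h.add_neg.continuousAt_productIntegral hz)
    refine h1.congr ?_
    filter_upwards [eventually_ne_nhds hz] with w hw
    rw [productDensity, if_neg hw]

theorem hasLogSingularityAt_productDensity (h : IsGaussianKernel g C a L) :
    HasLogSingularityAt (productDensity g) 0 := by
  refine ⟨if_pos rfl, fun x hx => ?_, g 0 0 + g (-0) (-0), h.add_neg.pos, ?_⟩
  · rw [productDensity, if_neg hx]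
    exact ENNReal.ofReal_lt_top
  · obtain ⟨M, hM⟩ := h.add_neg.exists_abs_productIntegral_add_log_le
    refine IsBigO.of_bound M ?_
    filter_upwards [self_mem_nhdsWithin, eventually_abs_lt_one_nhdsNE] with x hx hx1
    rw [productDensity, if_neg (show x ≠ 0 from hx), ENNReal.toReal_ofReal (h.add_neg.productIntegral_nonneg x),
      sub_zero, norm_one, mul_one]
    exact hM x hx hx1

end IsGaussianKernel

end GaussianKernel

/-! ### Convolution of square integrable densities. -/

section Convolution

theorem ENNReal.mul_le_sq_add_sq (x y : ℝ≥0∞) : x * y ≤ x ^ 2 + y ^ 2 := by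
  rcases le_total x y with h | h
  · exact (mul_le_mul_left h y).trans ((sq y).symm.le.trans le_add_self)
  · exact (mul_le_mul_right h x).trans ((sq x).symm.le.trans le_self_add)

variable {f h : ℝ → ℝ≥0∞}

/-- The majorant of the convolution integrand has an integral independent of `z`. -/
theorem lintegral_sq_add_sq_translate (hf : Measurable f) (z : ℝ) :
    ∫⁻ y, (f y ^ 2 + h (-y + z) ^ 2) = (∫⁻ y, f y ^ 2) + ∫⁻ y, h y ^ 2 := by
  rw [lintegral_add_left (by fun_prop)]
  congr 1
  have := lintegral_sub_left_eq_self (μ := (volume : Measure ℝ)) (fun y => h y ^ 2) z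
  rw [← this]
  refine lintegral_congr fun y => ?_
  rw [neg_add_eq_sub]

theorem lconvolution_le_lintegral_sq (hf : Measurable f) (z : ℝ) :
    (f ⋆ₗ[volume] h) z ≤ (∫⁻ y, f y ^ 2) + ∫⁻ y, h y ^ 2 := by
  rw [← lintegral_sq_add_sq_translate hf z, lconvolution_def]
  exact lintegral_mono fun y => ENNReal.mul_le_sq_add_sq _ _

/-- The convolution of two square integrable functions is continuous, if one of them is continuous
as a function with values in `[0, ∞]`. -/
theorem continuous_lconvolution_of_lintegral_sq (hf : Measurable f) (hh : Continuous h)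
    (hf2 : ∫⁻ y, f y ^ 2 ≠ ∞) (hh2 : ∫⁻ y, h y ^ 2 ≠ ∞) : Continuous (f ⋆ₗ[volume] h) := by
  have hhm := hh.measurable
  set K := (∫⁻ y, f y ^ 2) + ∫⁻ y, h y ^ 2 with hK
  have hKtop : K ≠ ∞ := ENNReal.add_ne_top.2 ⟨hf2, hh2⟩
  have hF : ∀ z, (f ⋆ₗ[volume] h) z = ∫⁻ y, f y * h (-y + z) := fun z => lconvolution_def
  have hFtop : ∀ z, ∫⁻ y, f y * h (-y + z) ≠ ∞ := fun z =>
    ne_top_of_le_ne_top hKtop ((hF z).symm.le.trans (lconvolution_le_lintegral_sq hf z))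
  -- Fatou's lemma applied to the product gives lower semicontinuity; applied to the slack `G`, it
  -- gives upper semicontinuity, since product and slack integrate to the constant `K`.
  set G : ℝ → ℝ≥0∞ := fun z => ∫⁻ y, (f y ^ 2 + h (-y + z) ^ 2 - f y * h (-y + z)) with hG
  have hGF : ∀ z, G z = K - ∫⁻ y, f y * h (-y + z) := fun z => by
    rw [hG, hK, ← lintegral_sq_add_sq_translate hf z]
    exact lintegral_sub (by fun_prop) (hFtop z)
      (ae_of_all _ fun y => ENNReal.mul_le_sq_add_sq _ _)
  have hFG : ∀ z, ∫⁻ y, f y * h (-y + z) = K - G z := fun z => by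
    rw [hGF, ENNReal.sub_sub_cancel hKtop]
    exact (hF z).symm.le.trans (lconvolution_le_lintegral_sq hf z)
  -- Infinite values would break continuity of multiplication and subtraction on `[0, ∞]`; square
  -- integrability confines them to a null set.
  have hf_fin : ∀ᵐ y, f y ≠ ∞ := by
    filter_upwards [ae_lt_top (by fun_prop) hf2] with y hy hy'
    simp [hy'] at hy
  have hh_fin : ∀ z : ℝ, ∀ᵐ y, h (-y + z) ≠ ∞ := fun z => by
    have h1 : ∫⁻ y, h (-y + z) ^ 2 ≠ ∞ := by
      refine ne_top_of_le_ne_top hKtop ?_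
      rw [hK, ← lintegral_sq_add_sq_translate hf z]
      exact lintegral_mono fun y => le_add_self
    filter_upwards [ae_lt_top (by fun_prop) h1] with y hy hy'
    simp [hy'] at hy
  have htend : ∀ z y : ℝ, Tendsto (fun w => h (-y + w)) (𝓝 z) (𝓝 (h (-y + z))) := fun z y =>
    (hh.comp (continuous_const.add continuous_id)).tendsto z
  have htendF : ∀ z : ℝ, ∀ᵐ y, Tendsto (fun w => f y * h (-y + w)) (𝓝 z)
      (𝓝 (f y * h (-y + z))) := fun z => by
    filter_upwards [hf_fin] with y hy
    exact ENNReal.Tendsto.const_mul (htend z y) (Or.inr hy)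
  rw [continuous_iff_continuousAt]
  intro z
  have hlow : ∫⁻ y, f y * h (-y + z) ≤ liminf (fun w => ∫⁻ y, f y * h (-y + w)) (𝓝 z) := by
    refine le_trans (le_of_eq (lintegral_congr_ae ?_))
      (lintegral_liminf_le fun w => by fun_prop)
    filter_upwards [htendF z] with y hy
    exact hy.liminf_eq.symm
  have hlowG : G z ≤ liminf G (𝓝 z) := by
    refine le_trans (le_of_eq (lintegral_congr_ae ?_))
      (lintegral_liminf_le fun w => by fun_prop)
    filter_upwards [htendF z, hf_fin, hh_fin z] with y hy hfy hhy
    refine (Tendsto.liminf_eq ?_).symm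
    refine ENNReal.Tendsto.sub (tendsto_const_nhds.add (ENNReal.Tendsto.pow (htend z y))) hy (Or.inr ?_)
    exact ENNReal.mul_ne_top hfy hhy
  refine tendsto_of_le_liminf_of_limsup_le ?_ ?_
  · rw [hF]
    exact hlow
  · simp only [hF]
    rw [hFG z]
    calc limsup (fun w => ∫⁻ y, f y * h (-y + w)) (𝓝 z) = limsup (fun w => K - G w) (𝓝 z) := by
          simp only [hFG]
      _ = K - liminf G (𝓝 z) := ENNReal.limsup_const_sub _ _ hKtop
      _ ≤ K - G z := tsub_le_tsub_left hlowG _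

/-- An integrable function dominated by `|z| ^ (-1/4)` is square integrable. -/
theorem lintegral_sq_ne_top_of_le_rpow {φ : ℝ → ℝ≥0∞} (hφ : ∫⁻ z, φ z ≠ ∞) {K : ℝ} (hK : 0 ≤ K)
    (hle : ∀ z, z ≠ 0 → φ z ≤ ENNReal.ofReal (K * |z| ^ (-(1 / 4) : ℝ))) :
    ∫⁻ z, φ z ^ 2 ≠ ∞ := by
  -- Inside the unit ball the squared bound is `K²|z|^(-1/2)`, which is integrable; outside, `φ ≤ K`
  -- gives `φ² ≤ Kφ`.
  have hint : IntegrableOn (fun z : ℝ => (K * |z| ^ (-(1 / 4) : ℝ)) ^ 2) (Metric.ball 0 1) := by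
    refine integrableOn_ball_of_norm_le_rpow (C := K ^ 2) (α := 1 / 2) (by simp)
      (by simp; norm_num) (ae_of_all _ fun z => le_of_eq ?_)
      (Measurable.aestronglyMeasurable (by fun_prop))
    rw [Real.norm_of_nonneg (sq_nonneg _), mul_pow, Real.norm_eq_abs, ← Real.rpow_natCast (_ ^ _),
      ← Real.rpow_mul (abs_nonneg z)]
    norm_num
  rw [← lintegral_add_compl _ (Metric.isOpen_ball (x := (0 : ℝ)) (ε := 1)).measurableSet]
  refine ENNReal.add_ne_top.2 ⟨?_, ?_⟩
  · refine ne_top_of_le_ne_top hint.lintegral_lt_top.ne (lintegral_mono_ae ?_)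
    filter_upwards [ae_restrict_of_ae (Measure.ae_ne volume (0 : ℝ))] with z hz
    rw [ENNReal.ofReal_pow (by positivity)]
    exact pow_le_pow_left' (hle z hz) 2
  · refine ne_top_of_le_ne_top (ENNReal.mul_ne_top (ENNReal.ofReal_ne_top (r := K)) hφ) ?_
    rw [← lintegral_const_mul' _ _ ENNReal.ofReal_ne_top]
    refine (setLIntegral_mono' Metric.isOpen_ball.measurableSet.compl fun z hz => ?_).trans
      (setLIntegral_le_lintegral _ _)
    have hz1 : 1 ≤ |z| := by simpa using hz
    have hz0 : z ≠ 0 := abs_pos.1 (one_pos.trans_le hz1)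
    rw [sq]
    gcongr
    refine (hle z hz0).trans (ENNReal.ofReal_le_ofReal ?_)
    exact mul_le_of_le_one_right hK (Real.rpow_le_one_of_one_le_of_nonpos hz1 (by norm_num))

/-- This keeps the induction on the number of summands within square integrable densities. -/
theorem lintegral_sq_ne_top_of_isBoundedOnReal (hf : ∫⁻ z, f z ≠ ∞) (hb : IsBoundedOnReal f) :
    ∫⁻ z, f z ^ 2 ≠ ∞ := by
  obtain ⟨M, hM⟩ := hb
  refine ne_top_of_le_ne_top (ENNReal.mul_ne_top (ENNReal.coe_ne_top (r := M)) hf) ?_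
  rw [← lintegral_const_mul' _ _ ENNReal.coe_ne_top]
  refine lintegral_mono fun z => ?_
  rw [sq]
  gcongr
  exact hM z

theorem IsContinuousPDF.lintegral_eq_one {Ω : Type*} [MeasurableSpace Ω] {P : Measure Ω}
    [IsProbabilityMeasure P] {S : Ω → ℝ} (hS : IsContinuousPDF S P f) : ∫⁻ z, f z = 1 := by
  have := hS.hasLaw.isProbabilityMeasure_iff.1 inferInstance
  rw [← setLIntegral_univ, ← withDensity_apply _ MeasurableSet.univ]
  exact this.measure_univ

theorem IsContinuousPDF.unique {Ω : Type*} [MeasurableSpace Ω] {P : Measure Ω}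
    [IsProbabilityMeasure P] {S : Ω → ℝ} (hf : IsContinuousPDF S P f)
    (hh : IsContinuousPDF S P h) : f = h := by
  rw [← Continuous.ae_eq_iff_eq volume hf.continuous hh.continuous,
    ← withDensity_eq_iff hf.continuous.aemeasurable hh.continuous.aemeasurable
      (by simp [hf.lintegral_eq_one]), ← hf.hasLaw.map_eq, ← hh.hasLaw.map_eq]

/-- A sum of independent variables with the same continuous square integrable density has a
continuous square integrable density, which is bounded if there are at least two summands. -/
theorem exists_isContinuousPDF_sum {Ω ι : Type*} [MeasurableSpace Ω] {P : Measure Ω}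
    [IsProbabilityMeasure P] {Z : ι → Ω → ℝ} (hZ : ∀ i, IsContinuousPDF (Z i) P f)
    (hf2 : ∫⁻ z, f z ^ 2 ≠ ∞) (hindep : iIndepFun Z P) {s : Finset ι} (hs : s.Nonempty) :
    ∃ F : ℝ → ℝ≥0∞, IsContinuousPDF (∑ i ∈ s, Z i) P F ∧ ∫⁻ z, F z ^ 2 ≠ ∞ ∧
      (2 ≤ s.card → IsBoundedOnReal F) := by
  induction hs using Finset.Nonempty.cons_induction with
  | singleton i => exact ⟨f, by simpa using hZ i, hf2, by simp⟩
  | cons i s hi hs ih =>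
    obtain ⟨F, hF, hF2, -⟩ := ih
    have hfm := (hZ i).continuous.measurable
    have hFm := hF.continuous.measurable
    have hb : IsBoundedOnReal (f ⋆ₗ[volume] F) := by
      refine ⟨((∫⁻ z, f z ^ 2) + ∫⁻ z, F z ^ 2).toNNReal, fun z => ?_⟩
      rw [ENNReal.coe_toNNReal (ENNReal.add_ne_top.2 ⟨hf2, hF2⟩)]
      exact lconvolution_le_lintegral_sq hfm z
    have hpdf : IsContinuousPDF (∑ j ∈ Finset.cons i s hi, Z j) P (f ⋆ₗ[volume] F) := by
      refine ⟨continuous_lconvolution_of_lintegral_sq hfm hF.continuous hf2 hF2, ?_⟩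
      have : SigmaFinite (volume.withDensity f) := by
        have := (hZ i).hasLaw.isProbabilityMeasure_iff.1 inferInstance
        infer_instance
      have : SigmaFinite (volume.withDensity F) := by
        have := hF.hasLaw.isProbabilityMeasure_iff.1 inferInstance
        infer_instance
      rw [Finset.sum_cons, ← conv_withDensity_eq_lconvolution hfm hFm]
      exact (hindep.indepFun_finsetSum_of_notMem₀ (fun j => (hZ j).hasLaw.aemeasurable)
        hi).symm.hasLaw_add (hZ i).hasLaw hF.hasLaw
    exact ⟨_, hpdf, lintegral_sq_ne_top_of_isBoundedOnReal (by simp [hpdf.lintegral_eq_one]) hb,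
      fun _ => hb⟩

end Convolution

/-! ### Assembly for the product and the sums. -/

/-- The product of the coordinates of a bivariate normal vector has a continuous density, which is
the product density of a Gaussian kernel. -/
theorem exists_isContinuousPDF_mul {Ω : Type*} [MeasurableSpace Ω] {P : Measure Ω}
    (μX μY σX σY ρ : ℝ) (hσX : 0 < σX) (hσY : 0 < σY) (hρ : -1 < ρ) (hρ' : ρ < 1) {X Y : Ω → ℝ}
    (hXY : HasLaw (fun ω => !₂[X ω, Y ω]) (bivariateNormal μX μY σX σY ρ) P) :
    ∃ g C a L, IsGaussianKernel g C a L ∧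
      IsContinuousPDF (fun ω => X ω * Y ω) P (productDensity g) := by
  have h₁ : (σX ^ 2).toNNReal ≠ 0 := (Real.toNNReal_pos.2 (by positivity)).ne'
  have h₂ : (σY ^ 2 * (1 - ρ ^ 2)).toNNReal ≠ 0 :=
    (Real.toNNReal_pos.2 (mul_pos (by positivity) (by nlinarith))).ne'
  obtain ⟨C, a, L, hg⟩ := isGaussianKernel_jointPDF μX (μY - ρ * σY / σX * μX) (ρ * σY / σX) h₁ h₂
  set g := jointPDF μX (σX ^ 2).toNNReal (μY - ρ * σY / σX * μX)
    (σY ^ 2 * (1 - ρ ^ 2)).toNNReal (ρ * σY / σX)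
  refine ⟨g, C, a, L, hg, hg.continuous_productDensity, ?_⟩
  have hmul : HasLaw (fun v : EuclideanSpace ℝ (Fin 2) => v 0 * v 1)
      (volume.withDensity (productDensity g)) (bivariateNormal μX μY σX σY ρ) := by
    refine ⟨Measurable.aemeasurable (by fun_prop), ?_⟩
    rw [bivariateNormal_eq_map μX μY σX σY ρ hσX hρ hρ', Measure.map_map (by fun_prop)
      (measurable_shear _)]
    refine (map_mul_gaussian _ _ _ h₁ h₂).trans (withDensity_congr_ae ?_)
    filter_upwards [Measure.ae_ne volume (0 : ℝ)] with z hz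
    exact hg.lintegral_eq_productDensity hz
  exact hmul.fun_comp hXY

theorem corollary2p2 {Ω Ω' : Type*} [MeasurableSpace Ω] [MeasurableSpace Ω']
    (P : Measure Ω) [IsProbabilityMeasure P] (P' : Measure Ω') [IsProbabilityMeasure P']
    (μX μY σX σY ρ : ℝ) (hσX : 0 < σX) (hσY : 0 < σY) (hρ : -1 < ρ) (hρ' : ρ < 1)
    (X Y : Ω' → ℝ)
    (hXY : HasLaw (fun ω => !₂[X ω, Y ω]) (bivariateNormal μX μY σX σY ρ) P')
    (n : ℕ) (hn : 1 ≤ n) (Z : Fin n → Ω → ℝ)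
    (hZ : ∀ i, IdentDistrib (Z i) (fun ω => X ω * Y ω) P P')
    (hindep : iIndepFun Z P) :
    (∃! f : ℝ → ℝ≥0∞, IsContinuousPDF (fun ω => ∑ i, Z i ω) P f) ∧
      ∀ f : ℝ → ℝ≥0∞, IsContinuousPDF (fun ω => ∑ i, Z i ω) P f →
        (IsBoundedOnReal f ↔ 2 ≤ n) ∧ (n = 1 → HasLogSingularityAt f 0) := by
  obtain ⟨g, C, a, L, hg, hpdf⟩ :=
    exists_isContinuousPDF_mul μX μY σX σY ρ hσX hσY hρ hρ' hXY
  have hZpdf : ∀ i, IsContinuousPDF (Z i) P (productDensity g) := fun i =>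
    ⟨hpdf.continuous, (hZ i).aemeasurable_fst, (hZ i).map_eq.trans hpdf.hasLaw.map_eq⟩
  have hsq : ∫⁻ z, productDensity g z ^ 2 ≠ ∞ := by
    obtain ⟨K, hK, hle⟩ := hg.productDensity_le_rpow
    exact lintegral_sq_ne_top_of_le_rpow (by simp [(hZpdf ⟨0, hn⟩).lintegral_eq_one]) hK hle
  have hne : (Finset.univ : Finset (Fin n)).Nonempty := ⟨⟨0, hn⟩, Finset.mem_univ _⟩
  obtain ⟨F, hF, -, hFb⟩ := exists_isContinuousPDF_sum hZpdf hsq hindep hne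
  have hsum : (∑ i, Z i) = fun ω => ∑ i, Z i ω := by
    ext ω
    simp
  rw [hsum] at hF
  rw [Finset.card_univ, Fintype.card_fin] at hFb
  refine ⟨⟨F, hF, fun f hf => hf.unique hF⟩, fun f hf => ?_⟩
  obtain rfl := hf.unique hF
  have hone : n = 1 → HasLogSingularityAt f 0 := by
    rintro rfl
    have hZ0 : IsContinuousPDF (fun ω => ∑ i, Z i ω) P (productDensity g) := by
      simpa using hZpdf 0
    rw [hf.unique hZ0]
    exact hg.hasLogSingularityAt_productDensity
  -- A bounded density excludes `n = 1`, where the value at `0` is `∞`.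
  refine ⟨⟨fun hb => ?_, hFb⟩, hone⟩
  by_contra hlt
  obtain ⟨M, hM⟩ := hb
  have htop := (hone (by omega)).1
  exact absurd (hM 0) (by simp [htop])
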